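/- Let $N\ge 0$ and let $S_N$ be the symmetric group on $N$ letters. Then $S_N$ is an $FSZ$-group; that is, for every integer $n\ge 1$ and every irreducible complex representation $V$ of the Drinfel'd double $D(S_N)$, the $n$-th Frobenius–Schur indicator $\nu_n(V)$ is a rational integer. Here, for a finite group $G$, $D(G)=\mathbb{C}^G\otimes\mathbb{C}G$ is the Hopf algebra over $\mathbb{C}$ with basis $e_g\otimes x$ ($g,x\in G$), product $(e_g\otimes x)(e_h\otimes y)=\delta_{g,\,xhx^{-1}}\,e_g\otimes xy$, unit $\sum_{g}e_g\otimes 1$, coproduct $\Delta(e_g\otimes x)=\sum_{hk=g}(e_h\otimes x)\otimes(e_k\otimes x)$, counit $\varepsilon(e_g\otimes x)=\delta_{g,1}$ and antipode $S(e_g\otimes x)=e_{x^{-1}g^{-1}x}\otimes x^{-1}$. Its normalized integral is $\Lambda=|G|^{-1}\sum_{x\in G}e_1\otimes x$ (the unique element with $h\Lambda=\varepsilon(h)\Lambda=\Lambda h$ for all $h\in D(G)$ and $\varepsilon(\Lambda)=1$). For a representation $V$ of $D(G)$ with character $\chi$, $\nu_n(V)=\chi(\Lambda^{[n]})$, where $h^{[n]}=h_1h_2\cdots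 h_n$ in Sweedler notation (the product of the tensor factors of the $n$-fold iterated coproduct of $h$). -/

import Mathlib

open scoped TensorProduct

set_option linter.unusedSectionVars false

universe u v

noncomputable section

/-- The underlying vector space of the Drinfel'd double `D(G) = ℂ^G ⊗ ℂG` of a finite group `G`
over `ℂ`: the complex vector space with basis `G × G`.  The pair `(g, x)` stands for the basis
vector `e_g ⊗ x`, where `e_g ∈ ℂ^G` is the indicator function of `{g}`. -/
def DrinfeldDouble (G : Type*) : Type _ := G × G →₀ ℂ

namespace DrinfeldDouble

section VectorSpace

variable {G : Type*}

instance : AddCommGroup (DrinfeldDouble G) := inferInstanceAs (AddCommGroup (G × G →₀ ℂ))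

instance : Module ℂ (DrinfeldDouble G) := inferInstanceAs (Module ℂ (G × G →₀ ℂ))

/-- The standard basis of `D(G)`. -/
def basis (G : Type*) : Module.Basis (G × G) ℂ (DrinfeldDouble G) :=
  Module.Basis.ofRepr (LinearEquiv.refl ℂ (G × G →₀ ℂ))

/-- The basis vector `e_g ⊗ x` of `D(G)`. -/
def e (g x : G) : DrinfeldDouble G := basis G (g, x)

/-- The linear map from `D(G)` with prescribed values on the basis vectors `e_g ⊗ x`. -/
def lift {M : Type*} [AddCommGroup M] [Module ℂ M] (f : G → G → M) : DrinfeldDouble G →ₗ[ℂ] M :=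
  (basis G).constr ℂ fun p => f p.1 p.2

@[simp] theorem lift_e {M : Type*} [AddCommGroup M] [Module ℂ M] (f : G → G → M) (g x : G) :
    lift f (e g x) = f g x := by
  simp [lift, e]

theorem hom_ext {M : Type*} [AddCommGroup M] [Module ℂ M] {φ ψ : DrinfeldDouble G →ₗ[ℂ] M}
    (h : ∀ g x, φ (e g x) = ψ (e g x)) : φ = ψ :=
  (basis G).ext fun p => h p.1 p.2

theorem induction_on [Nonempty G] {p : DrinfeldDouble G → Prop} (a : DrinfeldDouble G)
    (he : ∀ g x, p (e g x)) (hadd : ∀ a b, p a → p b → p (a + b))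
    (hsmul : ∀ (c : ℂ) a, p a → p (c • a)) : p a := by
  have hz : p 0 := by
    obtain ⟨g⟩ := ‹Nonempty G›
    simpa using hsmul 0 _ (he g g)
  have ha : a ∈ Submodule.span ℂ (Set.range (basis G)) := by
    rw [(basis G).span_eq]; trivial
  induction ha using Submodule.span_induction with
  | mem x hx => obtain ⟨q, rfl⟩ := hx; exact he q.1 q.2
  | zero => exact hz
  | add a b _ _ iha ihb => exact hadd a b iha ihb
  | smul c a _ iha => exact hsmul c a iha

instance [Finite G] : FiniteDimensional ℂ (DrinfeldDouble G) := (basis G).finiteDimensional_of_finite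

end VectorSpace

variable {G : Type*} [Group G] [Fintype G] [DecidableEq G]

/-- The multiplication of `D(G)` as a bilinear map:
`(e_g ⊗ x) (e_h ⊗ y) = δ_{g, x h x⁻¹} e_g ⊗ xy`. -/
def mulMap : DrinfeldDouble G →ₗ[ℂ] DrinfeldDouble G →ₗ[ℂ] DrinfeldDouble G :=
  lift fun g x => lift fun h y => if g = x * h * x⁻¹ then e g (x * y) else 0

instance : Mul (DrinfeldDouble G) := ⟨fun a b => mulMap a b⟩

instance : One (DrinfeldDouble G) := ⟨∑ g : G, e g 1⟩

theorem mul_def (a b : DrinfeldDouble G) : a * b = mulMap a b := rfl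

theorem one_def : (1 : DrinfeldDouble G) = ∑ g : G, e g 1 := rfl

theorem e_mul_e (g x h y : G) :
    e g x * e h y = if g = x * h * x⁻¹ then e g (x * y) else 0 := by
  simp [mul_def, mulMap]

theorem one_mul_aux (a : DrinfeldDouble G) : mulMap 1 a = a := by
  have : mulMap (1 : DrinfeldDouble G) = LinearMap.id :=
    hom_ext fun h y => by simp [one_def, mulMap]
  rw [this, LinearMap.id_apply]

theorem mul_one_aux (a : DrinfeldDouble G) : mulMap a 1 = a := by
  have : (mulMap (G := G)).flip 1 = LinearMap.id := hom_ext fun g x => by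
    have : ∀ h : G, (g = x * h * x⁻¹) ↔ (h = x⁻¹ * g * x) := fun h => by
      constructor
      · rintro rfl; group
      · rintro rfl; group
    simp [one_def, mulMap, this]
  exact congrArg (fun φ => φ a) this

theorem mul_assoc_aux (a b c : DrinfeldDouble G) :
    mulMap (mulMap a b) c = mulMap a (mulMap b c) := by
  induction a using induction_on with
  | hadd a a' h h' => simp only [map_add, LinearMap.add_apply, h, h']
  | hsmul r a h => simp only [map_smul, LinearMap.smul_apply, h]
  | he g x =>
    induction b using induction_on with
    | hadd b b' h h' => simp only [map_add, LinearMap.add_apply, h, h']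
    | hsmul r b h => simp only [map_smul, LinearMap.smul_apply, h]
    | he h y =>
      induction c using induction_on with
      | hadd c c' h h' => simp only [map_add, h, h']
      | hsmul r c h => simp only [map_smul, h]
      | he k z =>
        simp only [← mul_def, e_mul_e]
        by_cases h1 : g = x * h * x⁻¹ <;> by_cases h2 : h = y * k * y⁻¹
        · subst h2
          subst h1
          simp [mul_def, mulMap, mul_assoc]
        · have h3 : ¬ g = x * y * k * (x * y)⁻¹ := by
            rintro rfl
            apply h2
            have h1' := congrArg (fun t => x⁻¹ * t * x) h1
            simpa [mul_assoc] using h1'.symm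
          simp only [h1, h2, if_true, if_false]
          rw [← h1]
          simp only [mul_def, map_zero]
          rw [← mul_def, e_mul_e, if_neg h3]
        · simp only [h1, if_false]
          rw [if_pos h2]
          simp only [mul_def, map_zero, LinearMap.zero_apply]
          rw [← mul_def, e_mul_e, if_neg h1]
        · simp only [h1, h2, if_false, mul_def, map_zero, LinearMap.zero_apply]

instance : Ring (DrinfeldDouble G) :=
  { (inferInstance : AddCommGroup (DrinfeldDouble G)) with
    mul := (· * ·)
    one := 1
    left_distrib := fun a b c => map_add (mulMap a) b c
    right_distrib := fun a b c => by simp only [mul_def, map_add, LinearMap.add_apply]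
    zero_mul := fun a => by simp only [mul_def, map_zero, LinearMap.zero_apply]
    mul_zero := fun a => map_zero (mulMap a)
    mul_assoc := mul_assoc_aux
    one_mul := one_mul_aux
    mul_one := mul_one_aux }

instance : Algebra ℂ (DrinfeldDouble G) :=
  Algebra.ofModule
    (fun r a b => by simp only [mul_def, map_smul, LinearMap.smul_apply])
    (fun r a b => map_smul (mulMap a) r b)

/-- The coalgebra structure of `D(G)`: `Δ(e_g ⊗ x) = ∑_{hk = g} (e_h ⊗ x) ⊗ (e_k ⊗ x)` and
`ε(e_g ⊗ x) = δ_{g, 1}`. -/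
instance : CoalgebraStruct ℂ (DrinfeldDouble G) where
  comul := lift fun g x => ∑ h : G, e h x ⊗ₜ[ℂ] e (h⁻¹ * g) x
  counit := lift fun g _ => if g = 1 then 1 else 0

theorem comul_e (g x : G) :
    CoalgebraStruct.comul (R := ℂ) (e g x) = ∑ h : G, e h x ⊗ₜ[ℂ] e (h⁻¹ * g) x :=
  lift_e _ _ _

theorem counit_e (g x : G) :
    CoalgebraStruct.counit (R := ℂ) (e g x) = if g = 1 then 1 else 0 :=
  lift_e _ _ _

instance : Coalgebra ℂ (DrinfeldDouble G) where
  coassoc := hom_ext fun g x => by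
    simp only [LinearMap.comp_apply, comul_e, map_sum, LinearMap.rTensor_tmul,
      LinearMap.lTensor_tmul, TensorProduct.sum_tmul, TensorProduct.tmul_sum,
      LinearEquiv.coe_coe, TensorProduct.assoc_tmul]
    rw [Finset.sum_comm]
    refine Finset.sum_congr rfl fun h _ => ?_
    refine Fintype.sum_equiv (Equiv.mulLeft h⁻¹) _ _ fun k => ?_
    simp [mul_assoc]
  rTensor_counit_comp_comul := hom_ext fun g x => by
    simp only [LinearMap.comp_apply, comul_e, map_sum, LinearMap.rTensor_tmul, counit_e]
    rw [Finset.sum_eq_single 1 (fun h _ hh => by rw [if_neg hh, TensorProduct.zero_tmul])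
      (by simp)]
    simp
  lTensor_counit_comp_comul := hom_ext fun g x => by
    have : ∀ h : G, (h⁻¹ * g = 1) ↔ (h = g) := fun h => inv_mul_eq_one
    simp only [LinearMap.comp_apply, comul_e, map_sum, LinearMap.lTensor_tmul, counit_e, this]
    rw [Finset.sum_eq_single g (fun h _ hh => by rw [if_neg hh, TensorProduct.tmul_zero])
      (by simp)]
    simp

instance : Bialgebra ℂ (DrinfeldDouble G) :=
  Bialgebra.mk' ℂ (DrinfeldDouble G)
    (by simp [one_def, counit_e])
    (by
      intro a b
      induction a using induction_on with
      | hadd a a' h h' => simp only [map_add, add_mul, h, h']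
      | hsmul r a h => simp only [map_smul, smul_mul_assoc, h]
      | he g x =>
        induction b using induction_on with
        | hadd b b' h h' => simp only [map_add, mul_add, h, h']
        | hsmul r b h => simp only [map_smul, mul_smul_comm, h]
        | he h y =>
          rw [e_mul_e]
          by_cases h2 : h = 1
          · subst h2
            by_cases h1 : g = 1 <;> simp [counit_e, h1]
          · by_cases h1 : g = x * h * x⁻¹
            · simp [h1, counit_e, h2]
            · simp [h1, counit_e, h2])
    (by
      simp only [one_def, map_sum, comul_e, Algebra.TensorProduct.one_def,
        TensorProduct.sum_tmul, TensorProduct.tmul_sum]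
      rw [Finset.sum_comm]
      conv_rhs => rw [Finset.sum_comm]
      refine Finset.sum_congr rfl fun h _ => ?_
      exact Fintype.sum_equiv (Equiv.mulLeft h⁻¹) _ _ fun k => rfl)
    (by
      intro a b
      induction a using induction_on with
      | hadd a a' h h' => simp only [map_add, add_mul, h, h']
      | hsmul r a h => simp only [map_smul, smul_mul_assoc, h]
      | he g x =>
        induction b using induction_on with
        | hadd b b' h h' => simp only [map_add, mul_add, h, h']
        | hsmul r b h => simp only [map_smul, mul_smul_comm, h]
        | he h y =>
          have key : ∀ k l : G, (k = x * l * x⁻¹) ↔ (l = x⁻¹ * k * x) := fun k l => by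
            constructor
            · rintro rfl; group
            · rintro rfl; group
          rw [e_mul_e]
          simp only [comul_e, Finset.sum_mul_sum, Algebra.TensorProduct.tmul_mul_tmul, e_mul_e]
          by_cases h1 : g = x * h * x⁻¹
          · rw [if_pos h1, comul_e]
            refine Finset.sum_congr rfl fun k _ => ?_
            rw [Finset.sum_eq_single (x⁻¹ * k * x)]
            · rw [if_pos (by group), if_pos (by rw [h1]; group)]
            · intro l _ hl
              rw [if_neg (fun hh => hl ((key k l).1 hh)), TensorProduct.zero_tmul]
            · simp
          · rw [if_neg h1, map_zero]
            symm
            refine Finset.sum_eq_zero fun k _ => Finset.sum_eq_zero fun l _ => ?_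
            by_cases h2 : k = x * l * x⁻¹
            · have h3 : ¬ k⁻¹ * g = x * (l⁻¹ * h) * x⁻¹ := by
                intro h3
                apply h1
                have h4 : g = k * (k⁻¹ * g) := by group
                rw [h4, h3, h2]
                group
              rw [if_neg h3, TensorProduct.tmul_zero]
            · rw [if_neg h2, TensorProduct.zero_tmul])

/-- The antipode of `D(G)`: `S(e_g ⊗ x) = e_{x⁻¹ g⁻¹ x} ⊗ x⁻¹`. -/
instance : HopfAlgebra ℂ (DrinfeldDouble G) where
  antipode := lift fun g x => e (x⁻¹ * g⁻¹ * x) x⁻¹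
  mul_antipode_rTensor_comul := hom_ext fun g x => by
    have hc : CoalgebraStruct.comul (R := ℂ) (e g x) = ∑ h : G, e h x ⊗ₜ[ℂ] e (h⁻¹ * g) x :=
      comul_e g x
    have hd : CoalgebraStruct.counit (R := ℂ) (e g x) = if g = 1 then 1 else 0 := counit_e g x
    simp only [LinearMap.comp_apply, hc, hd, map_sum, LinearMap.rTensor_tmul, lift_e,
      LinearMap.mul'_apply, e_mul_e, Algebra.linearMap_apply]
    by_cases hg : g = 1
    · subst hg
      simp only [mul_one, inv_inv, if_true, map_one, inv_mul_cancel, one_def]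
      exact Fintype.sum_equiv ((MulAut.conj x⁻¹).toEquiv.trans (Equiv.inv G) ) _ _ fun h => by
        simp [mul_assoc]
    · simp [hg]
  mul_antipode_lTensor_comul := hom_ext fun g x => by
    have hc : CoalgebraStruct.comul (R := ℂ) (e g x) = ∑ h : G, e h x ⊗ₜ[ℂ] e (h⁻¹ * g) x :=
      comul_e g x
    have hd : CoalgebraStruct.counit (R := ℂ) (e g x) = if g = 1 then 1 else 0 := counit_e g x
    simp only [LinearMap.comp_apply, hc, hd, map_sum, LinearMap.lTensor_tmul, lift_e,
      LinearMap.mul'_apply, e_mul_e, Algebra.linearMap_apply]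
    by_cases hg : g = 1
    · subst hg
      simp [one_def, mul_assoc]
    · have : ∀ h : G, ¬ h = x * (x⁻¹ * (h⁻¹ * g)⁻¹ * x) * x⁻¹ := fun h hh => hg (by
        have h2 : g⁻¹ * h = h := by simpa [mul_assoc] using hh.symm
        simpa using h2)
      simp only [this, hg, if_false, Finset.sum_const_zero, map_zero]

/-- The normalized integral `Λ = |G|⁻¹ ∑_x e_1 ⊗ x` of `D(G)`. -/
def integral (G : Type*) [Group G] [Fintype G] : DrinfeldDouble G :=
  (Fintype.card G : ℂ)⁻¹ • ∑ x : G, e 1 x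

end DrinfeldDouble

section HopfAlgebra

variable {H : Type*} [Ring H] [HopfAlgebra ℂ H]

/-- `Λ` is a normalized (two-sided) integral of the Hopf algebra `H`:
`hΛ = ε(h)Λ = Λh` for all `h ∈ H`, and `ε(Λ) = 1`. -/
structure IsNormalizedIntegral (Λ : H) : Prop where
  mul_left : ∀ h : H, h * Λ = Coalgebra.counit (R := ℂ) h • Λ
  mul_right : ∀ h : H, Λ * h = Coalgebra.counit (R := ℂ) h • Λ
  counit_eq_one : Coalgebra.counit (R := ℂ) Λ = 1

theorem IsNormalizedIntegral.unique {Λ Λ' : H} (h : IsNormalizedIntegral Λ)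
    (h' : IsNormalizedIntegral Λ') : Λ = Λ' := by
  have h1 := h.mul_right Λ'
  rw [h'.mul_left, h.counit_eq_one, h'.counit_eq_one, one_smul, one_smul] at h1
  exact h1.symm

/-- The Sweedler power map `h ↦ h^{[n]} = h₁ h₂ ⋯ hₙ`, where `h₁ ⊗ ⋯ ⊗ hₙ` is the iterated
coproduct of `h`: one has `h^{[0]} = ε(h) 1` and `h^{[n+1]} = (h₁)^{[n]} h₂`. -/
def sweedlerPow (H : Type*) [Ring H] [HopfAlgebra ℂ H] : ℕ → H →ₗ[ℂ] H
  | 0 => Algebra.linearMap ℂ H ∘ₗ Coalgebra.counit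
  | n + 1 => LinearMap.mul' ℂ H ∘ₗ (sweedlerPow H n).rTensor H ∘ₗ Coalgebra.comul

/-- The character of an `H`-module `V`: `h ↦ tr (v ↦ h v)`. -/
def moduleCharacter (V : Type*) [AddCommGroup V] [Module ℂ V] [Module H V] [IsScalarTower ℂ H V]
    (h : H) : ℂ :=
  LinearMap.trace ℂ V (Algebra.lsmul ℂ ℂ V h)

end HopfAlgebra

namespace DrinfeldDouble

variable {G : Type*} [Group G] [Fintype G] [DecidableEq G]

theorem isNormalizedIntegral_integral : IsNormalizedIntegral (integral G) where
  mul_left a := by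
    induction a using induction_on with
    | hadd a b h h' => rw [add_mul, h, h', map_add, add_smul]
    | hsmul r a h => rw [smul_mul_assoc, h, map_smul, smul_smul, smul_eq_mul]
    | he g x =>
      have hd : Coalgebra.counit (R := ℂ) (e g x) = if g = 1 then 1 else 0 := counit_e g x
      simp only [integral, hd, mul_smul_comm, Finset.mul_sum, e_mul_e, mul_one, mul_inv_cancel]
      by_cases hg : g = 1
      · subst hg
        simp only [if_true, one_smul]
        congr 1
        exact Fintype.sum_equiv (Equiv.mulLeft x) _ _ fun y => rfl
      · simp [hg]
  mul_right a := by
    induction a using induction_on with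
    | hadd a b h h' => rw [mul_add, h, h', map_add, add_smul]
    | hsmul r a h => rw [mul_smul_comm, h, map_smul, smul_smul, smul_eq_mul]
    | he g x =>
      have hd : Coalgebra.counit (R := ℂ) (e g x) = if g = 1 then 1 else 0 := counit_e g x
      simp only [integral, hd, smul_mul_assoc, Finset.sum_mul, e_mul_e]
      by_cases hg : g = 1
      · subst hg
        simp only [mul_one, mul_inv_cancel, if_true, one_smul]
        congr 1
        exact Fintype.sum_equiv (Equiv.mulRight x) _ _ fun y => rfl
      · have : ∀ y : G, ¬ (1 : G) = y * g * y⁻¹ := fun y hy => hg (by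
          have := congrArg (fun t => y⁻¹ * t * y) hy
          simpa [mul_assoc] using this.symm)
        simp [hg, this]
  counit_eq_one := by
    have hd : ∀ x : G, Coalgebra.counit (R := ℂ) (e 1 x) = 1 := fun x => by
      have := counit_e (1 : G) x
      rwa [if_pos rfl] at this
    simp [integral, hd]

/-- Irreducible representations of `D(G)` are automatically finite-dimensional. -/
theorem finiteDimensional_of_isSimpleModule (V : Type*) [AddCommGroup V] [Module ℂ V]
    [Module (DrinfeldDouble G) V] [IsScalarTower ℂ (DrinfeldDouble G) V]
    [IsSimpleModule (DrinfeldDouble G) V] : FiniteDimensional ℂ V := by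
  have : Nontrivial V := IsSimpleModule.nontrivial (DrinfeldDouble G) V
  obtain ⟨v, hv⟩ := exists_ne (0 : V)
  have hs := IsSimpleModule.toSpanSingleton_surjective (DrinfeldDouble G) hv
  exact Module.Finite.of_surjective
    ((LinearMap.toSpanSingleton (DrinfeldDouble G) V v).restrictScalars ℂ) hs

/-- The `n`-th Frobenius-Schur indicator `ν_n(V) = χ_V(Λ^{[n]})` of a representation `V` of
`D(G)`. -/
def indicator (n : ℕ) (V : Type*) [AddCommGroup V] [Module ℂ V] [Module (DrinfeldDouble G) V]
    [IsScalarTower ℂ (DrinfeldDouble G) V] : ℂ :=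
  moduleCharacter V (sweedlerPow (DrinfeldDouble G) n (integral G))

end DrinfeldDouble

/-- `G` is an `FSZ_n`-group: the `n`-th Frobenius-Schur indicator of every irreducible
representation of `D(G)` is an integer. -/
def IsFSZn (n : ℕ) (G : Type u) [Group G] [Fintype G] [DecidableEq G] : Prop :=
  ∀ (V : Type v) [AddCommGroup V] [Module ℂ V] [Module (DrinfeldDouble G) V]
    [IsScalarTower ℂ (DrinfeldDouble G) V] [IsSimpleModule (DrinfeldDouble G) V],
    ∃ k : ℤ, DrinfeldDouble.indicator (G := G) n V = (k : ℂ)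

/-- `G` is an `FSZ`-group: it is an `FSZ_n`-group for every positive integer `n`. -/
def IsFSZ (G : Type u) [Group G] [Fintype G] [DecidableEq G] : Prop :=
  ∀ n : ℕ, 0 < n → IsFSZn.{u, v} n G

end

/-! A rational algebraic integer is an integer, so the indicator is shown to be both.

Integrality holds for every finite group: $\nu_n(V)$ is the trace of $PC$, with $P$ the projector
onto the invariants of $V^{\otimes n}$ and $C$ the cyclic rotation. These commute and $C$ has finite
order, so the eigenvalues are roots of unity or zero (`isIntegral_trace_sweedlerPow`).

For rationality, $\nu_n(V)=|G|^{-1}\sum_{h,z} c(h,z)\,\chi(e_h\otimes z)$, where $c(h,z)$ counts the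
$a$ with $a^n=z=(ah^{-1})^n$ (`indicator_eq_sum`). If $c(h,z)=c(h,z^m)$ for all $m$ prime to $|G|$,
averaging over $m$ leaves sums of $\chi(e_h\otimes z^m)$, which are integers by Möbius inversion and
traces of idempotents.

The symmetric group enters only in this invariance. A common solution is turned into one for $z^m$
by composing $a$ with $x\mapsto z^{(m-1)g(x)}x$, where $g$ is $z$-invariant and its values along $n$
steps of $a$, and also of $au$, add up to $1$ modulo the $z$-period. A single $g$ serves both
permutations because Hall's theorem gives a common transversal of their cycles. -/

/-! ### Common transversals of cycles -/

open Finset in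
/-- Two partitions of a finite set into blocks of the same size have a common transversal. -/
theorem exists_common_transversal {X α β : Type*} [Fintype X] [Fintype α] [Fintype β]
    [DecidableEq X] [DecidableEq α] [DecidableEq β] (f : X → α) (g : X → β) {B : ℕ} (hB : 0 < B)
    (hf : ∀ a, #{x | f x = a} = B) (hg : ∀ b, #{x | g x = b} = B) :
    ∃ S : Finset X, (∀ a, #{x ∈ S | f x = a} = 1) ∧ ∀ b, #{x ∈ S | g x = b} = 1 := by
  -- Hall's condition by double counting: the `#A * B` points of the chosen `f`-blocks lie in the
  -- `g`-blocks they meet, which hold `#U * B` points.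
  have hall : ∀ A : Finset α, #A ≤ #(A.biUnion fun a => ({x | f x = a} : Finset X).image g) := by
    intro A
    set U := A.biUnion fun a => ({x | f x = a} : Finset X).image g with hU
    have h1 : #({x | f x ∈ A} : Finset X) = #A * B := by
      rw [card_eq_sum_card_fiberwise (f := f) (t := A) (fun x hx => by simpa using hx),
        sum_const_nat (m := B)]
      intro a ha
      rw [← hf a, filter_filter]
      congr 1
      ext x
      simp only [mem_filter, mem_univ, true_and]
      exact ⟨fun h => h.2, fun h => ⟨h ▸ ha, h⟩⟩
    have h2 : #({x | g x ∈ U} : Finset X) = #U * B := by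
      rw [card_eq_sum_card_fiberwise (f := g) (t := U) (fun x hx => by simpa using hx),
        sum_const_nat (m := B)]
      intro a ha
      rw [← hg a, filter_filter]
      congr 1
      ext x
      simp only [mem_filter, mem_univ, true_and]
      exact ⟨fun h => h.2, fun h => ⟨h ▸ ha, h⟩⟩
    have h3 : #({x | f x ∈ A} : Finset X) ≤ #({x | g x ∈ U} : Finset X) := by
      refine card_le_card fun x hx => ?_
      simp only [mem_filter, mem_univ, true_and] at hx ⊢
      exact mem_biUnion.2 ⟨f x, hx, mem_image.2 ⟨x, by simp, rfl⟩⟩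
    rw [h1, h2] at h3
    exact Nat.le_of_mul_le_mul_right h3 hB
  obtain ⟨t, ht, htm⟩ := (all_card_le_biUnion_card_iff_exists_injective _).1 hall
  have hX : ∀ a, ∃ x, f x = a ∧ g x = t a := fun a => by
    simpa using htm a
  choose s hs1 hs2 using hX
  have hcα : Fintype.card X = Fintype.card α * B := by
    rw [← card_univ, card_eq_sum_card_fiberwise (f := f) (t := univ) (fun _ _ => by simp),
      sum_const_nat (fun a _ => hf a), card_univ]
  have hcβ : Fintype.card X = Fintype.card β * B := by
    rw [← card_univ, card_eq_sum_card_fiberwise (f := g) (t := univ) (fun _ _ => by simp),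
      sum_const_nat (fun a _ => hg a), card_univ]
  have hcard : Fintype.card α = Fintype.card β :=
    Nat.eq_of_mul_eq_mul_right hB (hcα.symm.trans hcβ)
  -- There are equally many blocks on both sides, so the matching also reaches every `g`-block.
  have hbij : Function.Bijective t := (Fintype.bijective_iff_injective_and_card t).2 ⟨ht, hcard⟩
  refine ⟨univ.image s, fun a => card_eq_one.2 ⟨s a, ?_⟩, fun b => ?_⟩
  · ext x
    simp only [mem_filter, mem_image, mem_univ, true_and, mem_singleton]
    constructor
    · rintro ⟨⟨a', rfl⟩, h⟩
      rw [hs1] at h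
      rw [h]
    · rintro rfl
      exact ⟨⟨a, rfl⟩, hs1 a⟩
  · obtain ⟨a, rfl⟩ := hbij.2 b
    refine card_eq_one.2 ⟨s a, ?_⟩
    ext x
    simp only [mem_filter, mem_image, mem_univ, true_and, mem_singleton]
    constructor
    · rintro ⟨⟨a', rfl⟩, h⟩
      rw [hs2] at h
      rw [ht h]
    · rintro rfl
      exact ⟨⟨a, rfl⟩, hs2 a⟩

namespace Equiv.Perm

open _root_.Finset Function

theorem sameCycle_iff_exists_lt_minimalPeriod {X : Type*} [Finite X] (p : Perm X) (x y : X) :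
    p.SameCycle x y ↔ ∃ j < minimalPeriod p x, (p ^ j) x = y := by
  constructor
  · intro h
    obtain ⟨j, -, hj⟩ := h.exists_pow_eq'
    refine ⟨j % minimalPeriod p x, Nat.mod_lt _ ?_, ?_⟩
    · exact minimalPeriod_pos_of_mem_periodicPts
        (mem_periodicPts.2 ⟨orderOf p, orderOf_pos p, by
          rw [IsPeriodicPt, IsFixedPt, ← coe_pow, pow_orderOf_eq_one, one_apply]⟩)
    · rw [coe_pow, iterate_mod_minimalPeriod_eq, ← coe_pow, hj]
  · rintro ⟨j, -, rfl⟩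
    exact ⟨j, rfl⟩

theorem sum_range_minimalPeriod {X M : Type*} [Fintype X] [DecidableEq X] [AddCommMonoid M]
    (p : Perm X) [DecidableRel p.SameCycle] (x : X) (f : X → M) :
    ∑ j ∈ range (minimalPeriod p x), f ((p ^ j) x) = ∑ y with p.SameCycle x y, f y := by
  rw [← sum_image (f := f) (g := fun j => (p ^ j) x)]
  · refine sum_congr ?_ fun _ _ => rfl
    ext y
    simp [sameCycle_iff_exists_lt_minimalPeriod]
  · intro i hi j hj h
    simp only [coe_range, Set.mem_Iio] at hi hj
    simp only [coe_pow] at h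
    exact iterate_injOn_Iio_minimalPeriod hi hj h

/-- For two permutations all of whose cycles have length `B`, there is a set meeting each cycle of
either permutation exactly once. -/
theorem exists_weight_of_minimalPeriod_eq {X : Type*} [Finite X] (p q : Perm X) {B : ℕ}
    (hB : 0 < B) (hp : ∀ x, minimalPeriod p x = B) (hq : ∀ x, minimalPeriod q x = B) :
    ∃ h : X → ℤ, (∀ x, ∑ j ∈ range B, h ((p ^ j) x) = 1) ∧
      ∀ x, ∑ j ∈ range B, h ((q ^ j) x) = 1 := by
  classical
  have := Fintype.ofFinite X
  have fiber : ∀ p : Perm X, (∀ x, minimalPeriod p x = B) →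
      ∀ a : Quotient (SameCycle.setoid p), #{x | (⟦x⟧ : Quotient (SameCycle.setoid p)) = a} = B := by
    intro p hp a
    induction a using Quotient.inductionOn with
    | h x =>
      have h := sum_range_minimalPeriod p x (fun _ => (1 : ℕ))
      rw [hp] at h
      simp only [sum_const, card_range, smul_eq_mul, mul_one] at h
      refine Eq.trans ?_ h.symm
      congr 1
      ext y
      simp only [mem_filter, mem_univ, true_and]
      rw [Quotient.eq]
      exact sameCycle_comm
  obtain ⟨S, h1, h2⟩ := exists_common_transversal _ _ hB (fiber p hp) (fiber q hq)
  have key : ∀ p : Perm X, (∀ x, minimalPeriod p x = B) →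
      (∀ a : Quotient (SameCycle.setoid p),
        #{x ∈ S | (⟦x⟧ : Quotient (SameCycle.setoid p)) = a} = 1) →
      ∀ x, ∑ j ∈ range B, (if (p ^ j) x ∈ S then (1 : ℤ) else 0) = 1 := by
    intro p hp h1 x
    have h := sum_range_minimalPeriod p x (fun y => if y ∈ S then (1 : ℤ) else 0)
    rw [hp] at h
    rw [h, ← sum_filter, sum_const, nsmul_one]
    norm_cast
    rw [← h1 ⟦x⟧, filter_filter]
    congr 1
    ext y
    simp only [mem_filter, mem_univ, true_and]
    rw [Quotient.eq, and_comm]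
    exact and_congr_right fun _ => sameCycle_comm
  exact ⟨fun x => if x ∈ S then 1 else 0, key p hp h1, key q hq h2⟩

end Equiv.Perm

/-! ### Weights adapted to two roots of one permutation -/

/-- For roots of a permutation with cycles of length `k`: taking an `l`-th root forces cycle length
`l * k`, while `m` is invertible modulo `k`. -/
theorem Nat.exists_eq_mul_coprime_of_pos (k : ℕ) {n : ℕ} (hn : 0 < n) :
    ∃ l m : ℕ, n = l * m ∧ (∀ r, r.Prime → r ∣ l → r ∣ k) ∧ m.Coprime k := by
  induction n using Nat.strong_induction_on with
  | _ n ih =>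
    by_cases h : n.Coprime k
    · exact ⟨1, n, by simp, fun r hr h1 => absurd h1 hr.not_dvd_one, h⟩
    · obtain ⟨p, hp, hpn, hpk⟩ := Nat.Prime.not_coprime_iff_dvd.1 h
      obtain ⟨n', rfl⟩ := hpn
      have hn' : 0 < n' := Nat.pos_of_mul_pos_left hn
      obtain ⟨l, m, hlm, h1, h2⟩ := ih n' (by nlinarith [hp.two_le]) hn'
      refine ⟨p * l, m, by rw [hlm, mul_assoc], fun r hr h3 => ?_, h2⟩
      rcases (hr.dvd_mul).1 h3 with h4 | h4
      · rwa [(Nat.prime_dvd_prime_iff_eq hr hp).1 h4]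
      · exact h1 r hr h4

namespace Equiv.Perm

open _root_.Finset Function

/-- The period divides `l * k`. If a prime `r` divided the quotient, then `r ∣ k`, and already `z ^
(k / r)` would fix `x`. -/
theorem minimalPeriod_eq_mul_of_pow_eq {X : Type*} {p z : Perm X} {k l : ℕ} (hk : 0 < k)
    (hpz : p ^ l = z) (hl : ∀ r, r.Prime → r ∣ l → r ∣ k) {x : X}
    (hx : minimalPeriod z x = k) : minimalPeriod p x = l * k := by
  have hdvd : minimalPeriod p x ∣ l * k := by
    apply IsPeriodicPt.minimalPeriod_dvd
    rw [IsPeriodicPt, IsFixedPt, ← coe_pow, pow_mul, hpz, coe_pow, ← hx]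
    exact iterate_minimalPeriod
  obtain ⟨c, hc⟩ := hdvd
  by_contra hne
  have hc1 : c ≠ 1 := by rintro rfl; exact hne (by rw [hc, mul_one])
  obtain ⟨r, hr, d, rfl⟩ := Nat.exists_prime_and_dvd hc1
  have hrk : r ∣ k := by
    have : r ∣ l * k := hc ▸ Dvd.intro_left (minimalPeriod p x * d) (by ring)
    rcases (hr.dvd_mul).1 this with h | h
    · exact hl r hr h
    · exact h
  obtain ⟨k', rfl⟩ := hrk
  have hk' : 0 < k' := Nat.pos_of_mul_pos_left hk
  have h1 : l * k' = minimalPeriod p x * d := by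
    apply Nat.eq_of_mul_eq_mul_left hr.pos
    rw [← mul_assoc, mul_comm r l, mul_assoc, hc]; ring
  have h2 : IsPeriodicPt z k' x := by
    rw [IsPeriodicPt, IsFixedPt, ← coe_pow, ← hpz, ← pow_mul, h1, coe_pow]
    exact (isPeriodicPt_minimalPeriod p x).mul_const d
  have h3 := h2.minimalPeriod_le hk'
  rw [hx] at h3
  nlinarith [hr.two_le]

end Equiv.Perm

theorem Finset.sum_range_mul_eq {M : Type*} [AddCommMonoid M] (f : ℕ → M) (r s : ℕ) :
    ∑ t ∈ Finset.range (r * s), f t =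
      ∑ i ∈ Finset.range r, ∑ j ∈ Finset.range s, f (r * j + i) := by
  rw [Finset.sum_comm]
  induction s with
  | zero => simp
  | succ s ih =>
    rw [mul_add, mul_one, Finset.sum_range_add, ih, Finset.sum_range_succ (n := s)]

namespace Equiv.Perm

open _root_.Finset Function

theorem minimalPeriod_apply_of_commute {X : Type*} {a z : Perm X} (h : Commute a z) (x : X) :
    minimalPeriod z (a x) = minimalPeriod z x := by
  rw [minimalPeriod_eq_minimalPeriod_iff]
  intro n
  rw [IsPeriodicPt, IsFixedPt, IsPeriodicPt, IsFixedPt, ← coe_pow, ← mul_apply,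
    ← (h.pow_right n).eq, mul_apply, a.injective.eq_iff]

theorem minimalPeriod_subtypePerm {X : Type*} {P : X → Prop} (z : Perm X)
    (hz : ∀ x, P (z x) ↔ P x) (x : {x // P x}) :
    minimalPeriod (z.subtypePerm hz) x = minimalPeriod z x := by
  rw [minimalPeriod_eq_minimalPeriod_iff]
  intro n
  rw [IsPeriodicPt, IsFixedPt, IsPeriodicPt, IsFixedPt, ← coe_pow, ← coe_pow, subtypePerm_pow,
    Subtype.ext_iff, subtypePerm_apply]

/-- With `n = l * m` split relative to `k`, both `a ^ m` and `b ^ m` have only cycles of length `l *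
k` on the points of `z`-period `k`, so a common transversal exists there. Summing its indicator over
`z`-orbits gives an invariant weight with total `m`, which is then scaled by an inverse of `m`
modulo `k`. -/
theorem exists_invariant_weight_of_minimalPeriod {X : Type*} [Finite X] {a b z : Perm X} {n : ℕ}
    (hn : 0 < n) (ha : a ^ n = z) (hb : b ^ n = z) (k : ℕ) :
    ∃ g : X → ℤ, (∀ x, g (z x) = g x) ∧ ∀ x, minimalPeriod z x = k →
      ((∑ j ∈ range n, g ((a ^ j) x)) ≡ 1 [ZMOD k]) ∧
        ((∑ j ∈ range n, g ((b ^ j) x)) ≡ 1 [ZMOD k]) := by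
  classical
  rcases Nat.eq_zero_or_pos k with rfl | hk
  · refine ⟨0, fun _ => rfl, fun x hx => absurd hx (Nat.pos_iff_ne_zero.1 ?_)⟩
    exact minimalPeriod_pos_of_mem_periodicPts
      (mem_periodicPts.2 ⟨orderOf z, orderOf_pos z, by
        rw [IsPeriodicPt, IsFixedPt, ← coe_pow, pow_orderOf_eq_one, one_apply]⟩)
  obtain ⟨l, m, rfl, hl, hm⟩ := Nat.exists_eq_mul_coprime_of_pos k hn
  have hl0 : 0 < l := Nat.pos_of_mul_pos_right hn
  have hz : ∀ x, minimalPeriod z (z x) = k ↔ minimalPeriod z x = k := fun x => by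
    rw [minimalPeriod_apply_of_commute (Commute.refl z)]
  have hcomm : ∀ {a : Perm X}, a ^ (l * m) = z → Commute a z := fun h =>
    h ▸ (Commute.refl _).pow_right _
  have hinv : ∀ {a : Perm X}, a ^ (l * m) = z →
      ∀ x, minimalPeriod z ((a ^ m) x) = k ↔ minimalPeriod z x = k := fun h x => by
    rw [minimalPeriod_apply_of_commute ((hcomm h).pow_left m)]
  have hper : ∀ {a : Perm X} (h : a ^ (l * m) = z) (x : {x // minimalPeriod z x = k}),
      minimalPeriod ((a ^ m).subtypePerm (hinv h)) x = l * k := fun {a} h x => by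
    refine minimalPeriod_eq_mul_of_pow_eq (z := z.subtypePerm hz) hk ?_ hl ?_
    · rw [subtypePerm_pow]
      ext y
      simp only [subtypePerm_apply]
      rw [← pow_mul, mul_comm, h]
    · rw [minimalPeriod_subtypePerm]
      exact x.2
  obtain ⟨h, h1, h2⟩ := exists_weight_of_minimalPeriod_eq _ _ (Nat.mul_pos hl0 hk)
    (hper ha) (hper hb)
  obtain ⟨c, hc⟩ : ∃ c : ℤ, c * m ≡ 1 [ZMOD k] := by
    obtain ⟨c, hc⟩ := Int.mod_coprime hm
    exact ⟨c, by rwa [mul_comm]⟩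
  let H : X → ℤ := fun x => if hx : minimalPeriod z x = k then h ⟨x, hx⟩ else 0
  refine ⟨fun x => c * ∑ j ∈ range k, H ((z ^ j) x), fun x => ?_, fun x hx => ?_⟩
  · have hHk : H ((z ^ k) x) = H x := by
      by_cases hx : minimalPeriod z x = k
      · congr 1
        rw [coe_pow, ← hx]
        exact iterate_minimalPeriod
      · have h3 : ¬ minimalPeriod z ((z ^ k) x) = k := by
          rwa [minimalPeriod_apply_of_commute ((Commute.refl z).pow_left k)]
        simp only [H, dif_neg hx, dif_neg h3]
    have h4 := sum_range_succ (fun j => H ((z ^ j) x)) k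
    rw [sum_range_succ', hHk, pow_zero, one_apply] at h4
    have h5 := add_right_cancel h4
    simp only [← h5, pow_succ, mul_apply]
  · have key : ∀ {a : Perm X} (ha : a ^ (l * m) = z),
        (∀ x, ∑ j ∈ range (l * k), h (((a ^ m).subtypePerm (hinv ha) ^ j) x) = 1) →
        ((∑ i ∈ range (l * m), c * ∑ j ∈ range k, H ((z ^ j) ((a ^ i) x))) ≡ 1 [ZMOD k]) := by
      intro a ha h1
      rw [← mul_sum]
      have e1 : ∀ i j, (z ^ j) ((a ^ i) x) = (a ^ (l * m * j + i)) x := fun i j => by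
        rw [← ha, ← pow_mul, pow_add, mul_apply]
      simp only [e1]
      -- The exponents run once through `0, …, l * m * k - 1`. Regrouped modulo `m`, they form `m`
      -- full cycles of `a ^ m`, each of weight one.
      rw [← sum_range_mul_eq (fun t => H ((a ^ t) x)), show l * m * k = m * (l * k) by ring,
        sum_range_mul_eq (fun t => H ((a ^ t) x))]
      have e2 : ∀ i, ∑ j ∈ range (l * k), H ((a ^ (m * j + i)) x) = 1 := fun i => by
        have hx' : minimalPeriod z ((a ^ i) x) = k := by
          rw [minimalPeriod_apply_of_commute ((hcomm ha).pow_left i), hx]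
        rw [← h1 ⟨(a ^ i) x, hx'⟩]
        refine sum_congr rfl fun j _ => ?_
        rw [pow_add, pow_mul, mul_apply, subtypePerm_pow]
        simp only [H, subtypePerm_apply]
        rw [dif_pos]
      simp only [e2, sum_const, card_range, nsmul_one]
      exact hc
    exact ⟨key ha h1, key hb h2⟩

/-- `g` assigns to each point a power of `z` such that the shifts accumulated along `n` steps of
`a` add up to `z`. -/
def IsRootWeight {X : Type*} (n : ℕ) (z a : Perm X) (g : X → ℤ) : Prop :=
  ∀ x, (z ^ (∑ j ∈ range n, g ((a ^ j) x))) x = z x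

/-- The weights for the various `z`-periods glue together: `a` and `b` commute with `z`, so the
period is constant along their orbits. -/
theorem exists_isRootWeight {X : Type*} [Finite X] {a b z : Perm X} {n : ℕ}
    (hn : 0 < n) (ha : a ^ n = z) (hb : b ^ n = z) :
    ∃ g : X → ℤ, (∀ x, g (z x) = g x) ∧ IsRootWeight n z a g ∧ IsRootWeight n z b g := by
  choose g hg1 hg2 using exists_invariant_weight_of_minimalPeriod hn ha hb
  have key : ∀ x (t : ℤ), t ≡ 1 [ZMOD minimalPeriod z x] → (z ^ t) x = z x := by
    intro x t ht
    obtain ⟨s, hs⟩ := ht.symm.dvd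
    have h1 : (z ^ minimalPeriod z x) x = x := by
      rw [coe_pow]
      exact iterate_minimalPeriod
    rw [show t = 1 + (minimalPeriod z x : ℤ) * s by linarith, zpow_add, zpow_one, mul_apply,
      zpow_mul, zpow_natCast, zpow_apply_eq_self_of_apply_eq_self h1]
  refine ⟨fun x => g (minimalPeriod z x) x, fun x => ?_, fun x => key _ _ ?_, fun x => key _ _ ?_⟩
  · simp only [minimalPeriod_apply_of_commute (Commute.refl z), hg1]
  · have hc : Commute a z := ha ▸ (Commute.refl _).pow_right _
    simp only [minimalPeriod_apply_of_commute (hc.pow_left _)]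
    exact (hg2 _ x rfl).1
  · have hc : Commute b z := hb ▸ (Commute.refl _).pow_right _
    simp only [minimalPeriod_apply_of_commute (hc.pow_left _)]
    exact (hg2 _ x rfl).2

/-! ### Twisting roots of `z` into roots of `z ^ m` -/

theorem apply_zpow_of_invariant {X Y : Type*} {z : Perm X} {g : X → Y} (hg : ∀ x, g (z x) = g x)
    (t : ℤ) (x : X) : g ((z ^ t) x) = g x := by
  induction t with
  | zero => simp
  | succ t ih => rw [add_comm, zpow_add, zpow_one, mul_apply, hg, ih]
  | pred t ih => rw [← ih, ← hg, ← mul_apply, ← zpow_one_add]; congr 3; ring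

/-- The permutation `x ↦ z ^ (t * g x) x` for a `z`-invariant `g`. -/
def twist {X : Type*} (z : Perm X) (t : ℤ) (g : X → ℤ) (hg : ∀ x, g (z x) = g x) : Perm X where
  toFun x := (z ^ (t * g x)) x
  invFun x := (z ^ (-(t * g x))) x
  left_inv x := by
    simp only [apply_zpow_of_invariant hg]
    rw [← mul_apply, ← zpow_add, neg_add_cancel, zpow_zero, one_apply]
  right_inv x := by
    simp only [apply_zpow_of_invariant hg]
    rw [← mul_apply, ← zpow_add, add_neg_cancel, zpow_zero, one_apply]

/-- The powers of `z` can be collected because `a` commutes with `z` and `g` is constant on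
`z`-orbits. The index is `j + 1` because the twist acts after `a`. -/
theorem twist_mul_pow_apply {X : Type*} {a z : Perm X} (h : Commute a z) (t : ℤ) {g : X → ℤ}
    (hg : ∀ x, g (z x) = g x) (i : ℕ) (x : X) :
    ((twist z t g hg * a) ^ i) x = (z ^ (t * ∑ j ∈ range i, g ((a ^ (j + 1)) x))) ((a ^ i) x) := by
  induction i with
  | zero => simp
  | succ i ih =>
    rw [pow_succ', mul_apply, ih, mul_apply, ← mul_apply a, (h.zpow_right _).eq, mul_apply,
      ← mul_apply a, ← pow_succ']
    change (z ^ (t * g _)) _ = _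
    rw [apply_zpow_of_invariant hg, ← mul_apply, ← zpow_add, sum_range_succ]
    congr 2
    ring_nf

/-- The accumulated shift acts at `x` like `z`, so the twist contributes `z ^ (m - 1)` on top of `a
^ n = z`. -/
theorem twist_mul_pow {X : Type*} {a z : Perm X} {n m : ℕ} (ha : a ^ n = z) {g : X → ℤ}
    (hg : ∀ x, g (z x) = g x) (h : IsRootWeight n z a g) :
    (twist z (m - 1) g hg * a) ^ n = z ^ m := by
  have hc : Commute a z := ha ▸ (Commute.refl _).pow_right _
  ext x
  have h1 := h x
  -- Shifting the window replaces `g x` by `g (z x)`, which is the same value.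
  have e1 : ∑ j ∈ range n, g ((a ^ (j + 1)) x) = ∑ j ∈ range n, g ((a ^ j) x) := by
    have h4 := sum_range_succ (fun j => g ((a ^ j) x)) n
    rw [sum_range_succ', ha, hg, pow_zero, one_apply] at h4
    exact add_right_cancel h4
  rw [twist_mul_pow_apply hc, e1, ha]
  set s := ∑ j ∈ range n, g ((a ^ j) x)
  have h2 : (z ^ (s - 1)) (z x) = z x := by
    rw [← mul_apply, ← zpow_add_one, sub_add_cancel, h1]
  have h3 : (z ^ ((s - 1) * (m - 1))) (z x) = z x := by
    rw [zpow_mul]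
    exact zpow_apply_eq_self_of_apply_eq_self h2 _
  rw [show ((m : ℤ) - 1) * s = (m - 1) + (s - 1) * (m - 1) by ring, zpow_add, mul_apply, h3,
    ← mul_apply, ← zpow_add_one, sub_add_cancel, zpow_natCast]

/-- A twist moves points only within `z`-orbits, where `g` is constant. Hence the admissible weights
can be read off from the twisted permutation. -/
theorem isRootWeight_twist_mul {X : Type*} {a z : Perm X} (hc : Commute a z) {n : ℕ} (t : ℤ)
    {g₀ : X → ℤ} (hg₀ : ∀ x, g₀ (z x) = g₀ x) (g : X → ℤ) (hg : ∀ x, g (z x) = g x) :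
    IsRootWeight n z (twist z t g₀ hg₀ * a) g ↔ IsRootWeight n z a g := by
  simp only [IsRootWeight, twist_mul_pow_apply hc, apply_zpow_of_invariant hg]

/-- Twisting `a` by a weight good for both `a` and `a * u` is injective, provided that the weight
can be recovered from the twisted permutation. -/
theorem card_root_le_card_root {X : Type*} [Fintype X] [DecidableEq X] (u z : Perm X) {n : ℕ}
    (hn : 0 < n) (m : ℕ) :
    #{a : Perm X | a ^ n = z ∧ (a * u) ^ n = z} ≤
      #{a : Perm X | a ^ n = z ^ m ∧ (a * u) ^ n = z ^ m} := by
  classical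
  let Q : Perm X → (X → ℤ) → Prop := fun a g =>
    (∀ x, g (z x) = g x) ∧ IsRootWeight n z a g ∧ IsRootWeight n z (a * u) g
  -- The choice depends on `a` only through the predicate `Q a`, which twisting preserves. The
  -- default `0` is `z`-invariant, so the twist is defined for every `a`.
  let G : Perm X → X → ℤ := fun a => if h : ∃ g, Q a g then h.choose else 0
  have hGinv : ∀ a x, G a (z x) = G a x := by
    intro a x
    by_cases h : ∃ g, Q a g
    · simp only [G, dif_pos h]
      exact h.choose_spec.1 x
    · simp only [G, dif_neg h, Pi.zero_apply]
  have hG : ∀ a, a ^ n = z → (a * u) ^ n = z → Q a (G a) := by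
    intro a h1 h2
    have h : ∃ g, Q a g := exists_isRootWeight hn h1 h2
    simp only [G, dif_pos h]
    exact h.choose_spec
  have hGt : ∀ a, a ^ n = z → (a * u) ^ n = z →
      G (twist z (m - 1) (G a) (hGinv a) * a) = G a := by
    intro a h1 h2
    have hc1 : Commute a z := h1 ▸ (Commute.refl _).pow_right _
    have hc2 : Commute (a * u) z := h2 ▸ (Commute.refl _).pow_right _
    have hQ : Q (twist z (m - 1) (G a) (hGinv a) * a) = Q a := by
      funext g
      refine propext (and_congr_right fun hg => ?_)
      rw [mul_assoc, isRootWeight_twist_mul hc1 _ _ _ hg, isRootWeight_twist_mul hc2 _ _ _ hg]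
    simp only [G, hQ]
  refine card_le_card_of_injOn (fun a => twist z (m - 1) (G a) (hGinv a) * a) ?_ ?_
  · intro a ha
    simp only [coe_filter, mem_univ, true_and, Set.mem_ofPred_eq] at ha ⊢
    obtain ⟨h1, h2⟩ := ha
    obtain ⟨-, hQ1, hQ2⟩ := hG a h1 h2
    exact ⟨twist_mul_pow h1 _ hQ1, by rw [mul_assoc]; exact twist_mul_pow h2 _ hQ2⟩
  · intro a ha b hb hab
    simp only [coe_filter, mem_univ, true_and, Set.mem_ofPred_eq] at ha hb hab
    have h1 : G a = G b := by
      rw [← hGt a ha.1 ha.2, ← hGt b hb.1 hb.2, hab]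
    simp only [h1] at hab
    exact mul_left_cancel hab

/-- The reverse inequality is the same one for `z ^ m`, with `m'` inverse to `m` modulo the order of
`z`. -/
theorem card_root_eq_card_root_pow {X : Type*} [Fintype X] [DecidableEq X] (u z : Perm X) {n : ℕ}
    (hn : 0 < n) {m : ℕ} (hm : (orderOf z).Coprime m) :
    #{a : Perm X | a ^ n = z ∧ (a * u) ^ n = z} =
      #{a : Perm X | a ^ n = z ^ m ∧ (a * u) ^ n = z ^ m} := by
  refine le_antisymm (card_root_le_card_root u z hn m) ?_
  obtain ⟨m', hm'⟩ := exists_pow_eq_self_of_coprime hm.symm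
  have h := card_root_le_card_root u (z ^ m) hn m'
  rwa [hm'] at h

end Equiv.Perm

/-! ### Rationality of the indicators -/

/-- Möbius inversion on `n.gcd m`; it trades a sum over exponents prime to `n` for sums over all
multiples of a divisor, which idempotents can handle. -/
theorem Finset.sum_coprime_eq_sum_moebius {R : Type*} [CommRing R] (n : ℕ) (hn : 0 < n)
    (f : ℕ → R) :
    ∑ m ∈ Finset.range n with n.Coprime m, f m =
      ∑ d ∈ n.divisors, (ArithmeticFunction.moebius d : R) *
        ∑ j ∈ Finset.range (n / d), f (d * j) := by
  have hmu : ∀ m, (if n.Coprime m then (1 : R) else 0) =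
      ∑ d ∈ n.divisors, if d ∣ m then (ArithmeticFunction.moebius d : R) else 0 := by
    intro m
    have h1 := congrArg (fun F : ArithmeticFunction ℤ => F (n.gcd m))
      ArithmeticFunction.moebius_mul_coe_zeta
    simp only [ArithmeticFunction.coe_mul_zeta_apply,
      ArithmeticFunction.one_apply] at h1
    rw [← Finset.sum_filter]
    have h2 : (n.divisors.filter fun d => d ∣ m) = (n.gcd m).divisors := by
      ext d
      simp only [Finset.mem_filter, Nat.mem_divisors, Nat.dvd_gcd_iff]
      have := Nat.gcd_pos_of_pos_left m hn
      constructor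
      · rintro ⟨⟨h1, -⟩, h2⟩; exact ⟨⟨h1, h2⟩, this.ne'⟩
      · rintro ⟨⟨h1, h2⟩, -⟩; exact ⟨⟨h1, hn.ne'⟩, h2⟩
    rw [h2]
    have h3 := congrArg (Int.cast : ℤ → R) h1
    push_cast at h3
    rw [h3]
  have hdiv : ∀ d ∈ n.divisors, ∑ m ∈ Finset.range n, (if d ∣ m then f m else 0) =
      ∑ j ∈ Finset.range (n / d), f (d * j) := by
    intro d hd
    obtain ⟨s, rfl⟩ := Nat.dvd_of_mem_divisors hd
    have hd0 : 0 < d := Nat.pos_of_mul_pos_right hn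
    rw [Nat.mul_div_cancel_left _ hd0, Finset.sum_range_mul_eq, Finset.sum_eq_single 0]
    · simp
    · intro i hi hi0
      refine Finset.sum_eq_zero fun j _ => if_neg fun h => ?_
      rw [Nat.dvd_add_right (Dvd.intro _ rfl)] at h
      exact hi0 (Nat.eq_zero_of_dvd_of_lt h (Finset.mem_range.1 hi))
    · intro h
      exact absurd (Finset.mem_range.2 hd0) h
  calc ∑ m ∈ Finset.range n with n.Coprime m, f m
      = ∑ m ∈ Finset.range n, (if n.Coprime m then 1 else 0) * f m := by
        rw [Finset.sum_filter]
        refine Finset.sum_congr rfl fun m _ => ?_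
        split_ifs <;> simp
    _ = ∑ m ∈ Finset.range n, ∑ d ∈ n.divisors,
          (ArithmeticFunction.moebius d : R) * (if d ∣ m then f m else 0) := by
        refine Finset.sum_congr rfl fun m _ => ?_
        rw [hmu, Finset.sum_mul]
        refine Finset.sum_congr rfl fun d _ => ?_
        split_ifs <;> simp
    _ = _ := by
        rw [Finset.sum_comm]
        refine Finset.sum_congr rfl fun d hd => ?_
        rw [← Finset.mul_sum, hdiv d hd]

theorem LinearMap.exists_nat_trace_eq_of_isIdempotentElem {K V : Type*} [Field K]
    [AddCommGroup V] [Module K V] [FiniteDimensional K V] {f : V →ₗ[K] V}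
    (h : IsIdempotentElem f) : ∃ k : ℕ, LinearMap.trace K V f = k :=
  ⟨_, (LinearMap.IsIdempotentElem.isProj_range f h).trace⟩

namespace DrinfeldDouble

variable {G : Type*} [Group G] [Fintype G] [DecidableEq G]

theorem sweedlerPow_zero_e (g x : G) :
    sweedlerPow (DrinfeldDouble G) 0 (e g x) = if g = 1 then 1 else 0 := by
  have hd : Coalgebra.counit (R := ℂ) (e g x) = if g = 1 then 1 else 0 := counit_e g x
  simp only [sweedlerPow, LinearMap.comp_apply, hd]
  split_ifs <;> simp

theorem sweedlerPow_succ_e (n : ℕ) (g x : G) :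
    sweedlerPow (DrinfeldDouble G) (n + 1) (e g x) =
      ∑ h : G, sweedlerPow (DrinfeldDouble G) n (e h x) * e (h⁻¹ * g) x := by
  have hc : CoalgebraStruct.comul (R := ℂ) (e g x) = ∑ h : G, e h x ⊗ₜ[ℂ] e (h⁻¹ * g) x :=
    comul_e g x
  simp only [sweedlerPow, LinearMap.comp_apply, hc, map_sum, LinearMap.rTensor_tmul,
    LinearMap.mul'_apply]

/-- A product of the `e (h k) x` survives only if each index is the previous one conjugated by
`x⁻¹`. The first index `h` then determines the tuple, whose product is `(h * x⁻¹) ^ n * x ^ n`. -/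
theorem sweedlerPow_e (n : ℕ) (g x : G) :
    sweedlerPow (DrinfeldDouble G) n (e g x) =
      ∑ h : G, if (h * x⁻¹) ^ n * x ^ n = g then e h (x ^ n) else 0 := by
  induction n generalizing g with
  | zero =>
    rw [sweedlerPow_zero_e]
    simp only [pow_zero, mul_one, eq_comm (a := (1 : G))]
    split_ifs
    · rfl
    · simp
  | succ n ih =>
    simp only [sweedlerPow_succ_e, ih, Finset.sum_mul, ite_mul, zero_mul]
    rw [Finset.sum_comm]
    refine Finset.sum_congr rfl fun h _ => ?_
    rw [Finset.sum_ite_eq, if_pos (Finset.mem_univ _), e_mul_e, ← pow_succ]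
    refine if_congr ?_ rfl rfl
    rw [pow_succ (h * x⁻¹), pow_succ' x]
    set A := (h * x⁻¹) ^ n
    constructor
    · intro h1
      rw [h1]
      group
    · rintro rfl
      group

/-- The uncollapsed form, to be matched with the action on the tensor power. -/
theorem sweedlerPow_e_eq_sum_tuple (n : ℕ) (g x : G) :
    sweedlerPow (DrinfeldDouble G) n (e g x) =
      ∑ h : Fin n → G, if (List.ofFn h).prod = g then (List.ofFn fun k => e (h k) x).prod else 0 := by
  induction n generalizing g with
  | zero =>
    rw [sweedlerPow_zero_e]
    simp [eq_comm]
  | succ n ih =>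
    rw [← (Fin.snocEquiv fun _ => G).sum_comp, Fintype.sum_prod_type_right]
    simp only [sweedlerPow_succ_e, ih, Finset.sum_mul, ite_mul, zero_mul]
    rw [Finset.sum_comm]
    refine Finset.sum_congr rfl fun h _ => ?_
    rw [Finset.sum_ite_eq, if_pos (Finset.mem_univ _)]
    simp only [Fin.snocEquiv, Equiv.coe_fn_mk, List.ofFn_succ', List.concat_eq_append,
      List.prod_append, List.prod_singleton, Fin.snoc_castSucc, Fin.snoc_last]
    simp only [← eq_inv_mul_iff_mul_eq]
    rw [Finset.sum_ite_eq', if_pos (Finset.mem_univ _)]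

section Character

variable (V : Type*) [AddCommGroup V] [Module ℂ V] [Module (DrinfeldDouble G) V]
  [IsScalarTower ℂ (DrinfeldDouble G) V]

theorem moduleCharacter_sum {ι : Type*} (s : Finset ι) (f : ι → DrinfeldDouble G) :
    moduleCharacter V (∑ i ∈ s, f i) = ∑ i ∈ s, moduleCharacter V (f i) := by
  simp only [moduleCharacter, map_sum]

theorem moduleCharacter_smul (c : ℂ) (a : DrinfeldDouble G) :
    moduleCharacter V (c • a) = c * moduleCharacter V a := by
  simp only [moduleCharacter, map_smul, smul_eq_mul]

theorem moduleCharacter_zero : moduleCharacter V (0 : DrinfeldDouble G) = 0 := by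
  simp only [moduleCharacter, map_zero]

theorem indicator_eq_sum (n : ℕ) :
    indicator (G := G) n V = (Fintype.card G : ℂ)⁻¹ * ∑ h : G, ∑ z : G,
      (Finset.card {a : G | a ^ n = z ∧ (a * h⁻¹) ^ n = z} : ℂ) * moduleCharacter V (e h z) := by
  simp only [indicator, integral, map_smul, map_sum, sweedlerPow_e, moduleCharacter_smul,
    moduleCharacter_sum]
  congr 1
  rw [Finset.sum_comm]
  refine Finset.sum_congr rfl fun h _ => ?_
  simp only [Finset.card_filter, Nat.cast_sum, Finset.sum_mul]
  rw [Finset.sum_comm]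
  refine Finset.sum_congr rfl fun x _ => ?_
  rw [Finset.sum_eq_single (x ^ n)]
  · have h1 : (h * x⁻¹) ^ n * x ^ n = 1 ↔ (x ^ n = x ^ n ∧ (x * h⁻¹) ^ n = x ^ n) := by
      rw [mul_eq_one_iff_eq_inv, ← inv_inj, ← inv_pow, inv_inv]
      simp
    simp only [h1]
    split_ifs <;> simp [moduleCharacter_zero]
  · intro z _ hz
    rw [if_neg fun h1 => hz h1.1.symm]
    simp
  · simp

/-- The sum `y` of the `e h (w ^ j)` satisfies `y * y = s • y`, so `y / s` acts as a projection,
whose trace is its rank. Here `s` need not be the exact order of `w`. -/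
theorem exists_nat_sum_pow_character [FiniteDimensional ℂ V] {h w : G} (hw : Commute h w) {s : ℕ}
    (hs : 0 < s) (hws : w ^ s = 1) :
    ∃ k : ℕ, ∑ j ∈ Finset.range s, moduleCharacter V (e h (w ^ j)) = s * k := by
  set y : DrinfeldDouble G := ∑ j ∈ Finset.range s, e h (w ^ j) with hy
  have hmul : ∀ i j, e h (w ^ i) * e h (w ^ j) = e h (w ^ (i + j)) := fun i j => by
    rw [e_mul_e, if_pos, pow_add]
    rw [← (hw.pow_right i).eq, mul_inv_cancel_right]
  have hwy : e h (w ^ 1) * y = y := by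
    simp only [hy, Finset.mul_sum, hmul]
    have h4 := Finset.sum_range_succ (fun j => e h (w ^ j)) s
    rw [Finset.sum_range_succ', hws, pow_zero] at h4
    simp only [add_comm 1]
    exact add_right_cancel h4
  have hwy' : ∀ i, e h (w ^ (i + 1)) * y = y := fun i => by
    induction i with
    | zero => exact hwy
    | succ i ih => rw [← hmul (i + 1) 1, mul_assoc, hwy, ih]
  have hyy : y * y = (s : ℂ) • y := by
    -- Cyclic shift of the sum, so that `hwy'` applies to every term.
    have h5 : y = ∑ j ∈ Finset.range s, e h (w ^ (j + 1)) := by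
      conv_lhs => rw [← hwy]
      simp only [hy, Finset.mul_sum, hmul, add_comm 1]
    conv_lhs => enter [1]; rw [h5]
    simp only [Finset.sum_mul, hwy', Finset.sum_const, Finset.card_range]
    exact (Nat.cast_smul_eq_nsmul ℂ s y).symm
  have hs0 : (s : ℂ) ≠ 0 := Nat.cast_ne_zero.2 hs.ne'
  have hid : IsIdempotentElem (Algebra.lsmul ℂ ℂ V ((s : ℂ)⁻¹ • y)) := by
    rw [IsIdempotentElem, ← map_mul, smul_mul_smul_comm, hyy, smul_smul]
    congr 2
    field_simp
  obtain ⟨k, hk⟩ := LinearMap.exists_nat_trace_eq_of_isIdempotentElem hid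
  refine ⟨k, ?_⟩
  have hk' : moduleCharacter V ((s : ℂ)⁻¹ • y) = k := hk
  rw [moduleCharacter_smul, hy, moduleCharacter_sum] at hk'
  rw [← hk', mul_inv_cancel_left₀ hs0]

theorem exists_int_sum_coprime_character [FiniteDimensional ℂ V] {h z : G} (hz : Commute h z) :
    ∃ k : ℤ, ∑ m ∈ Finset.range (Fintype.card G) with (Fintype.card G).Coprime m,
      moduleCharacter V (e h (z ^ m)) = k := by
  have key : ∀ d ∈ (Fintype.card G).divisors, ∃ k : ℤ,
      ∑ j ∈ Finset.range (Fintype.card G / d), moduleCharacter V (e h (z ^ (d * j))) = k := by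
    intro d hd
    have hd' := Nat.dvd_of_mem_divisors hd
    obtain ⟨k, hk⟩ := exists_nat_sum_pow_character V (hz.pow_right d)
      (Nat.div_pos (Nat.le_of_dvd Fintype.card_pos hd') (Nat.pos_of_mem_divisors hd))
      (show (z ^ d) ^ (Fintype.card G / d) = 1 by
        rw [← pow_mul, Nat.mul_div_cancel' hd', pow_card_eq_one])
    refine ⟨(Fintype.card G / d : ℕ) * k, ?_⟩
    simp only [← pow_mul] at hk
    rw [hk]
    push_cast
    rfl
  rw [Finset.sum_coprime_eq_sum_moebius _ Fintype.card_pos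
    (fun m => moduleCharacter V (e h (z ^ m)))]
  choose! k hk using key
  refine ⟨∑ d ∈ (Fintype.card G).divisors, ArithmeticFunction.moebius d * k d, ?_⟩
  rw [Finset.sum_congr rfl fun d hd => by rw [hk d hd]]
  push_cast
  rfl

/-- The indicators are rational when the numbers of common `n`-th roots are invariant under
powers coprime to the group order. -/
theorem exists_rat_indicator_eq [FiniteDimensional ℂ V] (n : ℕ)
    (hG : ∀ (u z : G) (m : ℕ), (Fintype.card G).Coprime m →
      Finset.card {a : G | a ^ n = z ∧ (a * u) ^ n = z} =
        Finset.card {a : G | a ^ n = z ^ m ∧ (a * u) ^ n = z ^ m}) :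
    ∃ q : ℚ, indicator (G := G) n V = q := by
  rw [indicator_eq_sum]
  set c : G → G → ℕ := fun h z => Finset.card {a : G | a ^ n = z ∧ (a * h⁻¹) ^ n = z} with hc
  set M := (Finset.range (Fintype.card G)).filter fun m => (Fintype.card G).Coprime m with hM
  have hM0 : (M.card : ℂ) ≠ 0 := by
    rw [hM, ← Nat.totient_eq_card_coprime]
    exact Nat.cast_ne_zero.2 (Nat.totient_pos.2 Fintype.card_pos).ne'
  -- Each of the `M.card` copies of the sum is reindexed by `z ↦ z ^ m`, a bijection of `G` that
  -- preserves the counts; then the sum over `m` is done first.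
  have key : ∀ h : G, ∃ k : ℤ,
      (M.card : ℂ) * ∑ z : G, (c h z : ℂ) * moduleCharacter V (e h z) = k := by
    intro h
    have hz : ∀ z : G, ∃ k : ℤ,
        (c h z : ℂ) * ∑ m ∈ M, moduleCharacter V (e h (z ^ m)) = k := by
      intro z
      by_cases h0 : c h z = 0
      · exact ⟨0, by simp [h0]⟩
      -- A nonzero count forces `h` to commute with `z`, since `a` and `a * h⁻¹` both do.
      · obtain ⟨a, ha⟩ := Finset.card_pos.1 (Nat.pos_of_ne_zero h0)
        simp only [Finset.mem_filter, Finset.mem_univ, true_and] at ha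
        have h1 : Commute a z := ha.1 ▸ (Commute.refl a).pow_right n
        have h2 : Commute (a * h⁻¹) z := ha.2 ▸ (Commute.refl (a * h⁻¹)).pow_right n
        have h3 : Commute h z := by
          have := h2.inv_left.mul_left h1
          simpa using this
        obtain ⟨k, hk⟩ := exists_int_sum_coprime_character V h3
        exact ⟨c h z * k, by rw [hk]; push_cast; rfl⟩
    choose k hk using hz
    refine ⟨∑ z, k z, ?_⟩
    push_cast
    simp only [← hk, Finset.mul_sum]
    rw [Finset.sum_comm (s := Finset.univ) (t := M), ← Finset.mul_sum, ← nsmul_eq_mul,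
      ← Finset.sum_const]
    refine Finset.sum_congr rfl fun m hm => ?_
    have hcop : (Fintype.card G).Coprime m := (Finset.mem_filter.1 hm).2
    rw [← (powCoprime (G := G) (n := m) (by rwa [Nat.card_eq_fintype_card])).sum_comp]
    refine Finset.sum_congr rfl fun z _ => ?_
    simp only [powCoprime_apply, hc, ← hG _ z m hcop]
  choose k hk using key
  refine ⟨(Fintype.card G : ℚ)⁻¹ * ((M.card : ℚ)⁻¹ * ∑ h, k h), ?_⟩
  push_cast
  simp only [← hk, ← Finset.mul_sum, inv_mul_cancel_left₀ hM0]
  rfl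

end Character

end DrinfeldDouble

/-! ### Integrality of the indicators -/

/-- The eigenvalues are roots of the monic integral polynomial `X ^ (n + 1) - X`. This form of the
hypothesis also admits non-invertible maps, such as a projection times a rotation. -/
theorem isIntegral_trace_of_pow_succ_eq {K V : Type*} [Field K] [IsAlgClosed K] [AddCommGroup V]
    [Module K V] [FiniteDimensional K V] {f : Module.End K V} {n : ℕ} (hn : 0 < n)
    (hf : f ^ (n + 1) = f) : IsIntegral ℤ (LinearMap.trace K V f) := by
  rw [Module.End.trace_eq_sum_roots_charpoly_of_splits (IsAlgClosed.splits _)]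
  refine IsIntegral.multiset_sum fun x hx => ?_
  have h1 : x ∈ spectrum K f :=
    (Module.End.mem_spectrum_iff_isRoot_charpoly f x).2 (Polynomial.isRoot_of_mem_roots hx)
  have h2 := spectrum.subset_polynomial_aeval f (Polynomial.X ^ (n + 1) - Polynomial.X)
    ⟨x, h1, rfl⟩
  simp only [map_sub, map_pow, Polynomial.aeval_X, hf, sub_self, Polynomial.eval_sub,
    Polynomial.eval_pow, Polynomial.eval_X] at h2
  have h3 : x ^ (n + 1) - x = 0 := by
    by_contra h
    refine h2 ?_
    rw [spectrum.mem_resolventSet_iff, sub_zero]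
    exact (IsUnit.mk0 _ h).map (algebraMap K (Module.End K V))
  refine ⟨Polynomial.X ^ (n + 1) - Polynomial.X, Polynomial.monic_X_pow_sub ?_, ?_⟩
  · rw [Polynomial.degree_X]
    exact_mod_cast Nat.succ_lt_succ hn
  · simpa using h3

namespace Matrix

variable {ι R : Type*} [Fintype ι] [DecidableEq ι] [CommRing R] {n : ℕ}

theorem isIntegral_trace_of_pow_succ_eq {K : Type*} [Field K] [IsAlgClosed K]
    {A : Matrix ι ι K} (hn : 0 < n) (hA : A ^ (n + 1) = A) : IsIntegral ℤ A.trace := by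
  rw [← Matrix.trace_toLin'_eq]
  refine _root_.isIntegral_trace_of_pow_succ_eq hn ?_
  rw [← Matrix.toLin'_pow, hA]

/-- The tensor product of a finite family of matrices. -/
def piTensor (A : Fin n → Matrix ι ι R) : Matrix (Fin n → ι) (Fin n → ι) R :=
  of fun i j => ∏ k, A k (i k) (j k)

theorem piTensor_apply (A : Fin n → Matrix ι ι R) (i j : Fin n → ι) :
    piTensor A i j = ∏ k, A k (i k) (j k) := rfl

theorem piTensor_mul (A B : Fin n → Matrix ι ι R) :
    piTensor A * piTensor B = piTensor fun k => A k * B k := by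
  ext i j
  simp only [mul_apply, piTensor_apply, Finset.prod_univ_sum, ← Finset.prod_mul_distrib,
    Fintype.piFinset_univ]

theorem piTensor_eq_zero {A : Fin n → Matrix ι ι R} (k : Fin n) (h : A k = 0) :
    piTensor A = 0 := by
  ext i j
  exact Finset.prod_eq_zero (Finset.mem_univ k) (by rw [h, zero_apply])

/-- A sum over paths from `s` to `t`: `cons s i` lists the row indices and `snoc i t` the column
indices. -/
theorem list_prod_ofFn_apply (A : Fin (n + 1) → Matrix ι ι R) (s t : ι) :
    (List.ofFn A).prod s t = ∑ i : Fin n → ι,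
      ∏ k, A k (Fin.cons (α := fun _ => ι) s i k) (Fin.snoc (α := fun _ => ι) i t k) := by
  induction n generalizing s with
  | zero => simp [Fin.snoc]
  | succ n ih =>
    rw [List.ofFn_succ, List.prod_cons, mul_apply, ← (Fin.consEquiv fun _ => ι).sum_comp,
      Fintype.sum_prod_type]
    refine Finset.sum_congr rfl fun r _ => ?_
    rw [ih, Finset.mul_sum]
    refine Finset.sum_congr rfl fun i _ => ?_
    simp only [Fin.consEquiv, Equiv.coe_fn_mk]
    rw [← Fin.cons_snoc_eq_snoc_cons, Fin.prod_univ_succ (n := n + 1)]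
    simp only [Fin.cons_zero, Fin.cons_succ]

/-- The cyclic rotation of the factors of a tensor power. -/
def rotatePerm (n : ℕ) (ι : Type*) : Equiv.Perm (Fin n → ι) :=
  Equiv.arrowCongr (finRotate n) (Equiv.refl ι)

theorem rotatePerm_symm_apply (j : Fin n → ι) : (rotatePerm n ι).symm j = j ∘ finRotate n := rfl

/-- In a closed path the column indices are the row indices rotated by one step. -/
theorem trace_piTensor_mul_permMatrix (A : Fin (n + 1) → Matrix ι ι R) :
    (piTensor A * (rotatePerm (n + 1) ι).permMatrix R).trace = (List.ofFn A).prod.trace := by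
  rw [PEquiv.mul_toMatrix_toPEquiv, trace, trace, ← (Fin.consEquiv fun _ => ι).sum_comp,
    Fintype.sum_prod_type]
  refine Finset.sum_congr rfl fun s _ => ?_
  rw [diag_apply, list_prod_ofFn_apply]
  refine Finset.sum_congr rfl fun i _ => ?_
  rw [diag_apply, submatrix_apply, piTensor_apply, rotatePerm_symm_apply, Fin.snoc_eq_cons_rotate]
  rfl

end Matrix

theorem List.prod_ofFn_comp_finRotate_eq_one_iff {G : Type*} [Group G] {n : ℕ} (h : Fin n → G) :
    (List.ofFn (h ∘ finRotate n)).prod = 1 ↔ (List.ofFn h).prod = 1 := by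
  cases n with
  | zero => simp
  | succ n =>
    have h1 : h ∘ finRotate (n + 1) = Fin.snoc (α := fun _ => G) (Fin.tail h) (h 0) := by
      rw [Fin.snoc_eq_cons_rotate, Fin.cons_self_tail]
      rfl
    rw [h1, List.ofFn_succ' (Fin.snoc _ _), List.concat_eq_append, List.prod_append,
      List.prod_singleton, List.ofFn_succ, List.prod_cons, mul_eq_one_comm]
    simp only [Fin.snoc_castSucc, Fin.snoc_last]
    rfl

namespace DrinfeldDouble

open Matrix

noncomputable section

variable {G : Type*} [Group G] [Fintype G] [DecidableEq G] {ι : Type*} [Fintype ι] [DecidableEq ι]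
  (ρ : DrinfeldDouble G →ₐ[ℂ] Matrix ι ι ℂ) (n : ℕ)

/-- The action of `x ∈ G` on the part of degree `1` of the `n`-th tensor power of a
representation. -/
def tensorAction (x : G) : Matrix (Fin n → ι) (Fin n → ι) ℂ :=
  ∑ h : Fin n → G, if (List.ofFn h).prod = 1 then piTensor fun k => ρ (e (h k) x) else 0

/-- For each tuple `h` only the conjugate tuple `x⁻¹ * h k * x` survives in the second factor, and
its product is still `1`. -/
theorem tensorAction_mul (x y : G) :
    tensorAction ρ n x * tensorAction ρ n y = tensorAction ρ n (x * y) := by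
  simp only [tensorAction, Finset.sum_mul]
  refine Finset.sum_congr rfl fun h _ => ?_
  split_ifs with h1
  · rw [Finset.mul_sum, Finset.sum_eq_single fun k => x⁻¹ * h k * x]
    · have h2 : (List.ofFn fun k => x⁻¹ * h k * x).prod = 1 := by
        have := congrArg (MulAut.conj x⁻¹) h1
        rw [map_list_prod, List.map_ofFn, map_one] at this
        simpa [Function.comp_def] using this
      rw [if_pos h2, piTensor_mul]
      congr 1
      funext k
      rw [← map_mul, e_mul_e, if_pos (by group)]
    · intro h' _ hh'
      obtain ⟨k, hk⟩ := Function.ne_iff.1 hh'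
      split_ifs
      · rw [piTensor_mul]
        refine piTensor_eq_zero k ?_
        rw [← map_mul, e_mul_e, if_neg, map_zero]
        intro h3
        apply hk
        rw [h3]
        group
      · rw [mul_zero]
    · simp
  · rw [zero_mul]

/-- Rotating a tuple conjugates its product, so the condition of having product `1` is invariant and
the sum over tuples can be reindexed. -/
theorem commute_tensorAction (x : G) :
    Commute (tensorAction ρ n x) ((rotatePerm n ι).permMatrix ℂ) := by
  rw [Commute, SemiconjBy, PEquiv.mul_toMatrix_toPEquiv, PEquiv.toMatrix_toPEquiv_mul]
  ext i j
  obtain ⟨i, rfl⟩ := (rotatePerm n ι).symm.surjective i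
  simp only [submatrix_apply, id, Equiv.apply_symm_apply]
  simp only [rotatePerm_symm_apply]
  simp only [tensorAction, Matrix.sum_apply]
  rw [← (rotatePerm n G).symm.sum_comp]
  refine Finset.sum_congr rfl fun h _ => ?_
  rw [rotatePerm_symm_apply]
  have hrot := List.prod_ofFn_comp_finRotate_eq_one_iff h
  by_cases hh : (List.ofFn h).prod = 1
  · rw [if_pos hh, if_pos (hrot.2 hh)]
    exact Equiv.prod_comp (finRotate n) fun k => ρ (e (h k) x) (i k) (j k)
  · rw [if_neg hh, if_neg (mt hrot.1 hh)]
    rfl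

/-- The projection onto the invariants of the `n`-th tensor power of a representation. -/
def tensorProj : Matrix (Fin n → ι) (Fin n → ι) ℂ :=
  (Fintype.card G : ℂ)⁻¹ • ∑ x : G, tensorAction ρ n x

theorem isIdempotentElem_tensorProj : IsIdempotentElem (tensorProj ρ n) := by
  have h0 : (Fintype.card G : ℂ) ≠ 0 := Nat.cast_ne_zero.2 Fintype.card_ne_zero
  have h1 : (∑ x : G, tensorAction ρ n x) * ∑ x : G, tensorAction ρ n x =
      (Fintype.card G : ℂ) • ∑ x : G, tensorAction ρ n x := by
    simp only [Finset.sum_mul_sum, tensorAction_mul]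
    have h2 : ∀ x : G, ∑ y : G, tensorAction ρ n (x * y) = ∑ y : G, tensorAction ρ n y :=
      fun x => Equiv.sum_comp (Equiv.mulLeft x) fun y => tensorAction ρ n y
    rw [Finset.sum_congr rfl fun x _ => h2 x, Finset.sum_const, Finset.card_univ,
      Nat.cast_smul_eq_nsmul]
  rw [IsIdempotentElem, tensorProj, smul_mul_smul_comm, h1, smul_smul]
  congr 1
  field_simp

/-- The trace equals that of `tensorProj * C`. As the factors commute, one being idempotent and the
other of finite order `d`, the product satisfies `A ^ (d + 1) = A`. -/
theorem isIntegral_trace_sweedlerPow :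
    IsIntegral ℤ (ρ (sweedlerPow (DrinfeldDouble G) (n + 1) (integral G))).trace := by
  set C := (rotatePerm (n + 1) ι).permMatrix ℂ with hC
  have htr : (ρ (sweedlerPow (DrinfeldDouble G) (n + 1) (integral G))).trace =
      (tensorProj ρ (n + 1) * C).trace := by
    simp only [integral, tensorProj, map_smul, map_sum, sweedlerPow_e_eq_sum_tuple, tensorAction,
      smul_mul_assoc, Finset.sum_mul, trace_smul, trace_sum]
    congr 1
    refine Finset.sum_congr rfl fun x _ => Finset.sum_congr rfl fun h _ => ?_
    split_ifs
    · rw [hC, trace_piTensor_mul_permMatrix, map_list_prod, List.map_ofFn]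
      rfl
    · rw [map_zero, zero_mul, trace_zero, trace_zero]
  have hcomm : Commute (tensorProj ρ (n + 1)) C :=
    (Commute.sum_left _ _ _ fun x _ => commute_tensorAction ρ (n + 1) x).smul_left _
  have hCpow : C ^ orderOf (rotatePerm (n + 1) ι)⁻¹ = 1 := by
    -- The homomorphism `permMatrixHom` sends a permutation to the matrix of its inverse.
    have h1 : C = permMatrixHom (R := ℂ) (rotatePerm (n + 1) ι)⁻¹ := by
      change C = ((rotatePerm (n + 1) ι)⁻¹)⁻¹.permMatrix ℂ
      rw [inv_inv]
    rw [h1, ← map_pow, pow_orderOf_eq_one, map_one]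
  rw [htr]
  refine Matrix.isIntegral_trace_of_pow_succ_eq (orderOf_pos (rotatePerm (n + 1) ι)⁻¹) ?_
  rw [hcomm.mul_pow, (isIdempotentElem_tensorProj ρ (n + 1)).pow_succ_eq, pow_succ, hCpow, one_mul]

theorem isIntegral_indicator (V : Type*) [AddCommGroup V] [Module ℂ V]
    [Module (DrinfeldDouble G) V] [IsScalarTower ℂ (DrinfeldDouble G) V] [FiniteDimensional ℂ V]
    {n : ℕ} (hn : 0 < n) : IsIntegral ℤ (indicator (G := G) n V) := by
  obtain ⟨n, rfl⟩ := Nat.exists_eq_succ_of_ne_zero hn.ne'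
  classical
  let b := Module.finBasis ℂ V
  have h := isIntegral_trace_sweedlerPow
    ((LinearMap.toMatrixAlgEquiv b).toAlgHom.comp (Algebra.lsmul ℂ ℂ V (A := DrinfeldDouble G))) n
  rw [indicator, moduleCharacter, LinearMap.trace_eq_matrix_trace ℂ b]
  exact h

/-- A finite group whose numbers of common `n`-th roots are invariant under powers coprime to the
group order is an `FSZ`-group. -/
theorem isFSZn_of_card_eq {G : Type u} [Group G] [Fintype G] [DecidableEq G] {n : ℕ} (hn : 0 < n)
    (hG : ∀ (u z : G) (m : ℕ), (Fintype.card G).Coprime m →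
      Finset.card {a : G | a ^ n = z ∧ (a * u) ^ n = z} =
        Finset.card {a : G | a ^ n = z ^ m ∧ (a * u) ^ n = z ^ m}) :
    IsFSZn.{u, v} n G := by
  intro V _ _ _ _ _
  have := finiteDimensional_of_isSimpleModule (G := G) V
  obtain ⟨q, hq⟩ := exists_rat_indicator_eq (G := G) V n hG
  have h1 := isIntegral_indicator (G := G) V hn
  rw [hq] at h1
  have h2 : IsIntegral ℤ q :=
    (isIntegral_algHom_iff (algebraMap ℚ ℂ).toIntAlgHom (algebraMap ℚ ℂ).injective).1 h1
  obtain ⟨k, rfl⟩ := IsIntegrallyClosed.isIntegral_iff.1 h2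
  exact ⟨k, by rw [hq]; simp⟩

end

end DrinfeldDouble

theorem mainTheorem7 (N : ℕ) : IsFSZ.{0, v} (Equiv.Perm (Fin N)) := by
  intro n hn
  refine DrinfeldDouble.isFSZn_of_card_eq hn fun u z m hm => ?_
  exact Equiv.Perm.card_root_eq_card_root_pow u z hn
    (Nat.Coprime.coprime_dvd_left orderOf_dvd_card hm)
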